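/- Let $m\ge 1$ and let $[b_1,b_2,\ldots,b_m]$ be an even continued fraction, that is, every $b_i$ is a nonzero even integer (positive or negative). Let $C[b_1,\ldots,b_m]$ be the associated 2-bridge link: its diagram (Conway's normal form) consists of $m$ two-strand twists with $|b_1|,\ldots,|b_m|$ crossings, placed on four strands alternately between the two middle strands and between two outer strands, beginning with the middle strands, and closed by caps; the diagram is alternating where consecutive $b_i$ have the same sign, and a change of sign between $b_i$ and $b_{i+1}$ means that it is not alternating between the corresponding twists. The handedness of the diagram and its orientation are fixed by the convention that the two strands of the first twist run in opposite directions and that the sign of the first crossing is the sign of $b_1$. Let $V_{[b_1,\ldots,b_m]}\in\mathbb{Z}[t^{1/2},t^{-1/2}]$ be the Jones polynomial of this oriented link, normalized by $V(\text{unknot})=1$ and $t^{-1}V(L_+)-t\,V(L_-)+(t^{-1/2}-t^{1/2})V(L_0)=0$. Its degree is the highest exponent of $t$ that occurs in it with nonzero coefficient, and its leading coefficient is the coefficient of that power of $t$. Then the degree of $V_{[b_1,\ldots,b_m]}$ is $$\sum_{i=1}^m \max\left((-1)^{i+1}b_i+\frac{\operatorname{sign}(b_ib_{i-1})}{2},\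 -\frac12\right),$$ where for $i=1$ one uses the convention $\operatorname{sign}(b_0)=1$, so that $\operatorname{sign}(b_1b_0)=\operatorname{sign}(b_1)$. Moreover, its leading coefficient is $(-1)^{m-\tau}$, where $\tau$ is the number of indices $1\le i<m$ such that the $i$-th and the $(i+1)$-st entry of the type sequence $$\bigl(\operatorname{sign}(b_1),\,-\operatorname{sign}(b_2),\,\ldots,\,(-1)^{m+1}\operatorname{sign}(b_m)\bigr)$$ are both $+$. -/

import Mathlib

/-!
# Oriented link diagrams, the Jones polynomial and two-bridge links

Link diagrams are given in plat position: a word in the braid generators on `n + 1` horizontal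
strands, read from left to right, whose ends are joined on the left and on the right by planar
systems of caps. Every link in 3-space has such a diagram. The Jones polynomial is defined by the
state sum of the Kauffman bracket and the writhe.
-/

/-- An unoriented link diagram in plat position. The strands occupy the rows `0, …, n` (heights,
counted upwards). The `k`-th letter `(i, u)` of `word` is a crossing, in the column between the
positions `k` and `k + 1`, of the strands in the rows `i` and `i + 1`. If `u = true`, then the
strand running from lower left to upper right is the overstrand; if `u = false`, then the strand
running from upper left to lower right is the overstrand. At the left end, the row `r` is joined to
the row `left r` by a cap; at the right end, to the row `right r`. Caps do not cross each other. -/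
structure LinkDiagram where
  n : ℕ
  word : List (Fin n × Bool)
  left : Fin (n + 1) → Fin (n + 1)
  right : Fin (n + 1) → Fin (n + 1)
  left_left : ∀ r, left (left r) = r
  left_ne : ∀ r, left r ≠ r
  left_planar : ∀ r s, r < s → s < left r → r < left s ∧ left s < left r
  right_right : ∀ r, right (right r) = r
  right_ne : ∀ r, right r ≠ r
  right_planar : ∀ r s, r < s → s < right r → r < right s ∧ right s < right r

namespace LinkDiagram

variable (D : LinkDiagram)

/-- The crossings of the diagram. -/
abbrev Crossing : Type := Fin D.word.length

/-- The points of the diagram at the positions `0, 1, …, length` between the crossing columns: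
the pair `(k, r)` is the point at the horizontal position `k` in the row `r`. -/
abbrev Point : Type := Fin (D.word.length + 1) × Fin (D.n + 1)

/-- The lower row of a crossing. -/
abbrev low (k : D.Crossing) : Fin (D.n + 1) := (D.word.get k).1.castSucc

/-- The upper row of a crossing. -/
abbrev high (k : D.Crossing) : Fin (D.n + 1) := (D.word.get k).1.succ

/-- Whether the strand from lower left to upper right is the overstrand. -/
abbrev risingOver (k : D.Crossing) : Bool := (D.word.get k).2

/-- A Kauffman state: a choice of the `A`-smoothing (`true`) or of the `B`-smoothing (`false`) at
each crossing. -/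
abbrev State : Type := D.Crossing → Bool

/-- The arcs between points of the curve system obtained from the diagram by smoothing each
crossing according to a state.

The `A`-smoothing joins the two regions that the overstrand sweeps out when it is rotated
counterclockwise. If the overstrand runs from lower left to upper right, these are the upper and the
lower region, so that the `A`-smoothing joins the two left ends to each other and the two right ends
to each other (`turnLeft`, `turnRight`), while the `B`-smoothing consists of two horizontal arcs
(`acrossLow`, `acrossHigh`). If the overstrand runs from upper left to lower right, it is the other
way round. -/
inductive Arc (s : D.State) : D.Point → D.Point → Prop
  | capLeft (r : Fin (D.n + 1)) : Arc s (0, r) (0, D.left r)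
  | capRight (r : Fin (D.n + 1)) : Arc s (Fin.last _, r) (Fin.last _, D.right r)
  | straight (k : D.Crossing) (r : Fin (D.n + 1)) (hl : r ≠ D.low k) (hh : r ≠ D.high k) :
      Arc s (k.castSucc, r) (k.succ, r)
  | turnLeft (k : D.Crossing) (h : s k = D.risingOver k) :
      Arc s (k.castSucc, D.low k) (k.castSucc, D.high k)
  | turnRight (k : D.Crossing) (h : s k = D.risingOver k) :
      Arc s (k.succ, D.low k) (k.succ, D.high k)
  | acrossLow (k : D.Crossing) (h : s k ≠ D.risingOver k) :
      Arc s (k.castSucc, D.low k) (k.succ, D.low k)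
  | acrossHigh (k : D.Crossing) (h : s k ≠ D.risingOver k) :
      Arc s (k.castSucc, D.high k) (k.succ, D.high k)

/-- The number of closed curves of a state: the number of classes of points under the equivalence
relation generated by the arcs. It is always positive. -/
noncomputable def loops (s : D.State) : ℕ := Nat.card (Quot (D.Arc s))

/-- An orientation of all the strands of a diagram: `dir p = true` means that the strand through
the point `p` is directed to the right there, `dir p = false` that it is directed to the left.
Directions are reversed along a cap and are kept along every strand that passes a column, where the
two strands of the crossing exchange their rows. -/
structure Orientation where
  dir : D.Point → Bool
  dir_left : ∀ r, dir (0, D.left r) = !dir (0, r)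
  dir_right : ∀ r, dir (Fin.last _, D.right r) = !dir (Fin.last _, r)
  dir_cross : ∀ (k : D.Crossing) (r : Fin (D.n + 1)),
    dir (k.succ, Equiv.swap (D.low k) (D.high k) r) = dir (k.castSucc, r)

variable {D}

/-- The sign of a crossing of an oriented diagram: it is `1` if a counterclockwise rotation by an
angle less than `π` takes the direction of the overstrand to the direction of the understrand, and
`-1` otherwise. If the overstrand runs from lower left to upper right, the sign is `1` precisely when
the two strands cross the column in opposite horizontal directions; otherwise, precisely when they
cross it in the same direction. -/
def Orientation.sign (o : D.Orientation) (k : D.Crossing) : ℤ :=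
  if D.risingOver k = (o.dir (k.castSucc, D.low k) != o.dir (k.castSucc, D.high k)) then 1 else -1

/-- The writhe: the sum of the signs of all crossings. -/
def Orientation.writhe (o : D.Orientation) : ℤ := ∑ k, o.sign k

end LinkDiagram

/-- Polynomials with integer coefficients in rational powers of `t`; this ring contains the ring of
Laurent polynomials in `t ^ (1 / 2)`. -/
abbrev FracPoly : Type := AddMonoidAlgebra ℤ ℚ

/-- The monomial `t ^ q`. -/
noncomputable def tPow (q : ℚ) : FracPoly := AddMonoidAlgebra.single q 1

/-- The Kauffman bracket of a diagram, as a sum over all states, written in the variable `t` by the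
substitution `A = t ^ (-1 / 4)`. A state with `a` smoothings of type `A`, `b` smoothings of type `B`
and `l` closed curves contributes `A ^ (a - b) * (- A ^ 2 - A ^ (-2)) ^ (l - 1)`. -/
noncomputable def LinkDiagram.bracket (D : LinkDiagram) : FracPoly :=
  ∑ s : D.State, (∏ k, if s k then tPow (-1 / 4) else tPow (1 / 4)) *
    (-tPow (-1 / 2) - tPow (1 / 2)) ^ (D.loops s - 1)

/-- The Jones polynomial of an oriented link diagram with writhe `w`, namely `(-A) ^ (-3 * w)` times
the bracket, where `A = t ^ (-1 / 4)`; thus `(-A) ^ (-3 * w) = (-1) ^ w * t ^ (3 * w / 4)`. -/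
noncomputable def LinkDiagram.Orientation.jones {D : LinkDiagram} (o : D.Orientation) : FracPoly :=
  (Int.negOnePow o.writhe : ℤ) • (tPow (3 * (o.writhe : ℚ) / 4) * D.bracket)

/-- The crossings of the diagram of `C[b 1, …, b m]` on four strands: the `i`-th piece is a twist
of `|b i|` equal crossings, in the two middle rows `1, 2` if `i` is odd and in the two lower rows
`0, 1` if `i` is even. If `b i` is positive, then the overstrands are rising for odd `i` and falling
for even `i` (so that the diagram alternates as long as the signs of the `b i` agree); if `b i` is
negative, it is the other way round. -/
def twoBridgeWord (m : ℕ) (b : ℕ → ℤ) : List (Fin 3 × Bool) :=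
  (List.range m).flatMap fun j =>
    List.replicate (b (j + 1)).natAbs
      (if Odd (j + 1) then (1, decide (0 < b (j + 1))) else (0, decide (b (j + 1) < 0)))

/-- The standard diagram of the two-bridge link `C[b 1, …, b m]` (Conway's normal form). On the left,
caps join the rows `0, 1` and `2, 3`. On the right, caps join the rows `0, 1` and `2, 3` if `m` is
odd, and the rows `0, 3` and `1, 2` if `m` is even. -/
def twoBridge (m : ℕ) (b : ℕ → ℤ) : LinkDiagram where
  n := 3
  word := twoBridgeWord m b
  left := ![1, 0, 3, 2]
  right := if Odd m then ![1, 0, 3, 2] else ![3, 2, 1, 0]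
  left_left := by decide
  left_ne := by decide
  left_planar := by decide
  right_right := by split_ifs <;> decide
  right_ne := by split_ifs <;> decide
  right_planar := by split_ifs <;> decide

/-- The convention for the orientation of `C[b 1, …, b m]`: the sign of the first crossing is the
sign of `b 1`. -/
def IsConventional (m : ℕ) (b : ℕ → ℤ) (o : (twoBridge m b).Orientation) : Prop :=
  ∀ h : 0 < (twoBridge m b).word.length, o.sign ⟨0, h⟩ = (b 1).sign

/-- The `i`-th entry of the type sequence of `[b 1, …, b m]`. -/
def typeSeq (b : ℕ → ℤ) (i : ℕ) : ℤ := (-1) ^ (i + 1) * (b i).sign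

/-- The number of times that `+, +` occurs as a pair of consecutive entries in the type sequence of
`[b 1, …, b m]`. -/
def plusPlusCount (m : ℕ) (b : ℕ → ℤ) : ℕ :=
  ((Finset.Ico 1 m).filter fun i => typeSeq b i = 1 ∧ typeSeq b (i + 1) = 1).card

/-! Put e_i = (-1)^(i+1) b_i. Each twist has an even number of crossings, so it permutes the strands
trivially, and the conventional orientation makes adjacent strands antiparallel. All crossings of
the i-th twist then have the sign of e_i, and the writhe is the even number ∑ e_i (`writhe_eq`).

The bracket is computed by removing twists from the left. Let P_j and Q_j be the brackets of the
twists j, …, m, times t^(3(e_j + … + e_m)/4), closed on the left by the caps that do not,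
respectively do, join the rows of the j-th twist. Smoothing crossings (`bracket_cons`,
`bracket_twist_of_not_cap`) gives P_j = t^(e_j) Q_{j+1} + (t^(e_j) - 1)/(t^(1/2) + t^(-1/2)) P_{j+1}
and Q_j = P_{j+1}, with P_{m+1} = 1 and Q_{m+1} = -t^(-1/2) - t^(1/2); the Jones polynomial is P_1.

The two terms of P_j never have equal degree (`hasLead_of_recursion`). If e_j < 0, the second
dominates: the degree changes by -1/2, the leading coefficient by -1. If e_j and e_{j+1} are
positive, the second dominates, contributing e_j - 1/2 and the factor 1. If e_j > 0 is followed by a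
negative entry or by none, the first dominates, contributing e_j + 1/2 and -1. In a maximal run of
positive entries this gives the exceptional +1/2 to the last entry, whereas the stated formula gives
it to the first; the totals agree (`sum_max_eq_recDegree`). -/

/-! ### Leading terms of polynomials with rational exponents -/

/-- The exponents of `t` in `p` are at most `d`, and `t ^ d` has the coefficient `c`. -/
def HasLead (p : FracPoly) (d : ℚ) (c : ℤ) : Prop :=
  p.coeff d = c ∧ ∀ q, d < q → p.coeff q = 0

theorem tPow_zero : tPow 0 = 1 := rfl

theorem tPow_mul_tPow (p q : ℚ) : tPow p * tPow q = tPow (p + q) := by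
  simp [tPow, AddMonoidAlgebra.single_mul_single]

namespace HasLead

theorem of_tPow (d : ℚ) : HasLead (tPow d) d 1 := by
  refine ⟨by simp [tPow], fun q hq => ?_⟩
  rw [tPow, AddMonoidAlgebra.coeff_single, Finsupp.single_eq_of_ne hq.ne']

theorem neg {p : FracPoly} {d : ℚ} {c : ℤ} (h : HasLead p d c) : HasLead (-p) d (-c) := by
  refine ⟨?_, fun q hq => ?_⟩
  · rw [AddMonoidAlgebra.coeff_neg, Finsupp.neg_apply, h.1]
  · rw [AddMonoidAlgebra.coeff_neg, Finsupp.neg_apply, h.2 q hq, neg_zero]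

theorem add_of_lt {p q : FracPoly} {d d' : ℚ} {c c' : ℤ} (hp : HasLead p d c)
    (hq : HasLead q d' c') (h : d' < d) : HasLead (p + q) d c := by
  refine ⟨?_, fun r hr => ?_⟩
  · rw [AddMonoidAlgebra.coeff_add, Finsupp.add_apply, hp.1, hq.2 d h, add_zero]
  · rw [AddMonoidAlgebra.coeff_add, Finsupp.add_apply, hp.2 r hr, hq.2 r (h.trans hr), add_zero]

theorem add_of_gt {p q : FracPoly} {d d' : ℚ} {c c' : ℤ} (hp : HasLead p d c)
    (hq : HasLead q d' c') (h : d < d') : HasLead (p + q) d' c' :=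
  add_comm q p ▸ hq.add_of_lt hp h

theorem le_of_mem_support {p : FracPoly} {d : ℚ} {c : ℤ} (h : HasLead p d c) {q : ℚ}
    (hq : q ∈ p.coeff.support) : q ≤ d := by
  by_contra! hlt
  exact Finsupp.mem_support_iff.1 hq (h.2 q hlt)

theorem mul {p q : FracPoly} {d d' : ℚ} {c c' : ℤ} (hp : HasLead p d c) (hq : HasLead q d' c') :
    HasLead (p * q) (d + d') (c * c') := by
  refine ⟨?_, fun r hr => ?_⟩
  -- Exponents bounded by d and d' add up to d + d' only if both bounds are attained.
  · rw [AddMonoidAlgebra.coeff_mul_add_of_uniqueAdd, hp.1, hq.1]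
    intro x y hx hy hxy
    have h1 := hp.le_of_mem_support hx
    have h2 := hq.le_of_mem_support hy
    constructor <;> linarith
  · by_contra hne
    obtain ⟨x, hx, y, hy, rfl⟩ := Finset.mem_add.1
      (AddMonoidAlgebra.support_coeff_mul_subset p q (Finsupp.mem_support_iff.2 hne))
    have h1 := hp.le_of_mem_support hx
    have h2 := hq.le_of_mem_support hy
    linarith

end HasLead

/-! ### The Laurent polynomial of a twist -/

/-- The sum of the first `k` powers of `t ^ (2 * ε)`. -/
noncomputable def geomTPow (ε : ℤ) (k : ℕ) : FracPoly := ∑ j ∈ Finset.range k, tPow (2 * ε * j)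

theorem geomTPow_succ (ε : ℤ) (k : ℕ) :
    geomTPow ε (k + 1) = geomTPow ε k + tPow (2 * ε * k) :=
  Finset.sum_range_succ _ _

theorem hasLead_geomTPow_one (k : ℕ) : HasLead (geomTPow 1 (k + 1)) (2 * k) 1 := by
  induction k with
  | zero => simpa [geomTPow] using HasLead.of_tPow 0
  | succ k ih =>
    rw [geomTPow_succ]
    have := ih.add_of_gt (HasLead.of_tPow (2 * (1 : ℤ) * (k + 1 : ℕ))) (by push_cast; linarith)
    simpa only [Int.cast_one, mul_one] using this

theorem hasLead_geomTPow_neg_one (k : ℕ) : HasLead (geomTPow (-1) (k + 1)) 0 1 := by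
  induction k with
  | zero => simpa [geomTPow] using HasLead.of_tPow 0
  | succ k ih =>
    rw [geomTPow_succ]
    refine ih.add_of_lt (HasLead.of_tPow _) ?_
    push_cast
    have : (0 : ℚ) ≤ k := by positivity
    linarith

/-- The quotient of `t ^ e - 1` by `t ^ (1 / 2) + t ^ (-1 / 2)`, for an even integer `e`. -/
noncomputable def twistQuot (e : ℤ) : FracPoly :=
  geomTPow e.sign (e.natAbs / 2) * (tPow (3 * e.sign / 2) - tPow (e.sign / 2))

theorem hasLead_twistQuot_of_pos {e : ℤ} (he : Even e) (h : 0 < e) :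
    HasLead (twistQuot e) (e - 1 / 2) 1 := by
  obtain ⟨k, rfl⟩ := he
  obtain ⟨k, rfl⟩ : ∃ n : ℕ, k = n + 1 := ⟨(k - 1).toNat, by omega⟩
  have hk : ((k : ℤ) + 1 + (k + 1)).natAbs / 2 = k + 1 := by omega
  rw [twistQuot, Int.sign_eq_one_of_pos h, hk]
  have h2 : HasLead (tPow (3 * (1 : ℤ) / 2) - tPow ((1 : ℤ) / 2)) (3 / 2) 1 := by
    rw [sub_eq_add_neg]
    have := (HasLead.of_tPow (3 * (1 : ℤ) / 2)).add_of_lt (HasLead.of_tPow ((1 : ℤ) / 2)).neg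
      (by norm_num)
    convert this using 1; norm_num
  convert (hasLead_geomTPow_one k).mul h2 using 1
  · push_cast; ring
  · norm_num

theorem hasLead_twistQuot_of_neg {e : ℤ} (he : Even e) (h : e < 0) :
    HasLead (twistQuot e) (-1 / 2) (-1) := by
  obtain ⟨k, rfl⟩ := he
  obtain ⟨k, rfl⟩ : ∃ n : ℕ, k = -(n + 1) := ⟨(-k - 1).toNat, by omega⟩
  have hk : (-((k : ℤ) + 1) + -(k + 1)).natAbs / 2 = k + 1 := by omega
  rw [twistQuot, Int.sign_eq_neg_one_of_neg h, hk]
  have h2 : HasLead (tPow (3 * (-1 : ℤ) / 2) - tPow ((-1 : ℤ) / 2)) (-1 / 2) (-1) := by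
    rw [sub_eq_add_neg]
    have := (HasLead.of_tPow (3 * (-1 : ℤ) / 2)).add_of_gt (HasLead.of_tPow ((-1 : ℤ) / 2)).neg
      (by norm_num)
    convert this using 1; norm_num
  convert (hasLead_geomTPow_neg_one k).mul h2 using 1
  · ring
  · norm_num

/-! ### Degree and leading coefficient of the recursion -/

/-- The degree of the polynomials defined by the recursion for the twists `e j, …, e (j + n - 1)`. -/
def recDegree (e : ℕ → ℤ) : ℕ → ℕ → ℚ
  | _, 0 => 0
  | j, n + 1 => recDegree e (j + 1) n +
      if e j < 0 then (-1 / 2 : ℚ)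
      else if 0 < n ∧ 0 < e (j + 1) then (e j : ℚ) - 1 / 2 else (e j : ℚ) + 1 / 2

/-- The leading coefficient of the polynomials defined by the recursion for the twists
`e j, …, e (j + n - 1)`. -/
def recCoeff (e : ℕ → ℤ) : ℕ → ℕ → ℤ
  | _, 0 => 1
  | j, n + 1 => recCoeff e (j + 1) n * if 0 < e j ∧ 0 < n ∧ 0 < e (j + 1) then 1 else -1

/-- No cancellation occurs at the top because the gap between the degrees of P and Q is controlled
by the sign of the first remaining entry. -/
theorem hasLead_of_recursion {e : ℕ → ℤ} {P Q : ℕ → ℕ → FracPoly} {m : ℕ}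
    (he : ∀ i, 1 ≤ i → i ≤ m → Even (e i) ∧ e i ≠ 0)
    (hP0 : P (m + 1) 0 = 1) (hQ0 : Q (m + 1) 0 = -tPow (-1 / 2) - tPow (1 / 2))
    (hP : ∀ j n, 1 ≤ j → j + n = m →
      P j (n + 1) = tPow (e j) * Q (j + 1) n + twistQuot (e j) * P (j + 1) n)
    (hQ : ∀ j n, 1 ≤ j → j + n = m → Q j (n + 1) = P (j + 1) n) (n : ℕ) :
    ∀ j, 1 ≤ j → j + n = m + 1 → HasLead (P j n) (recDegree e j n) (recCoeff e j n) := by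
  -- The induction also carries the leading term of Q: its degree is below deg P - 1/2 if the first
  -- entry is positive, and is exactly deg P + 1/2 with opposite coefficient otherwise. The empty
  -- sequence belongs to the second case.
  suffices H : ∀ j, 1 ≤ j → j + n = m + 1 → HasLead (P j n) (recDegree e j n) (recCoeff e j n) ∧
      ∃ d c, HasLead (Q j n) d c ∧ (0 < n ∧ 0 < e j → d + 1 / 2 < recDegree e j n) ∧
        (¬ (0 < n ∧ 0 < e j) → d = recDegree e j n + 1 / 2 ∧ c = -recCoeff e j n) from
    fun j h1 h2 => (H j h1 h2).1
  induction n with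
  | zero =>
    rintro j - rfl
    refine ⟨by rw [hP0]; exact HasLead.of_tPow 0, 1 / 2, -1, ?_, by simp, by
      simp [recDegree, recCoeff]⟩
    rw [hQ0, sub_eq_add_neg]
    exact (HasLead.of_tPow _).neg.add_of_gt (HasLead.of_tPow _).neg (by norm_num)
  | succ n ih =>
    intro j h1 h2
    obtain ⟨hP', d, c, hQ', hpos, hneg⟩ := ih (j + 1) (by omega) (by omega)
    obtain ⟨hev, hne⟩ := he j h1 (by omega)
    rw [hP j n h1 (by omega), hQ j n h1 (by omega)]
    have ht := (HasLead.of_tPow (e j)).mul hQ'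
    rcases lt_or_gt_of_ne hne with hlt | hgt
    · have hle : (e j : ℚ) ≤ -2 := by
        have : e j ≤ -2 := by obtain ⟨k, hk⟩ := hev; omega
        exact_mod_cast this
      have hq := (hasLead_twistQuot_of_neg hev hlt).mul hP'
      have hd : d ≤ recDegree e (j + 1) n + 1 / 2 := by
        by_cases hc : 0 < n ∧ 0 < e (j + 1)
        · linarith [hpos hc]
        · exact (hneg hc).1.le
      have hD : recDegree e j (n + 1) = -1 / 2 + recDegree e (j + 1) n := by
        simp only [recDegree, if_pos hlt]; ring
      have hC : recCoeff e j (n + 1) = -1 * recCoeff e (j + 1) n := by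
        simp [recCoeff, hlt.not_gt]
      rw [hD, hC]
      exact ⟨ht.add_of_gt hq (by linarith), _, _, hP', fun h => absurd h.2 hlt.not_gt,
        fun _ => ⟨by ring, by ring⟩⟩
    -- Evenness matters here: for e_j = e_{j+1} = 1, the strict inequality deg Q_j + 1/2 < deg P_j
    -- would fail.
    · have hge : (2 : ℚ) ≤ e j := by
        have : 2 ≤ e j := by obtain ⟨k, hk⟩ := hev; omega
        exact_mod_cast this
      have hq := (hasLead_twistQuot_of_pos hev hgt).mul hP'
      by_cases hc : 0 < n ∧ 0 < e (j + 1)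
      · have hD : recDegree e j (n + 1) = e j - 1 / 2 + recDegree e (j + 1) n := by
          simp only [recDegree, if_neg hgt.not_gt, if_pos hc]; ring
        have hC : recCoeff e j (n + 1) = 1 * recCoeff e (j + 1) n := by
          simp [recCoeff, hgt, hc]
        rw [hD, hC]
        have := hpos hc
        exact ⟨ht.add_of_gt hq (by linarith), _, _, hP', fun _ => by linarith,
          fun h => absurd ⟨n.succ_pos, hgt⟩ h⟩
      -- Now deg Q_{j+1} = deg P_{j+1} + 1/2, so the first term exceeds the second by a full unit of
      -- degree.
      · obtain ⟨rfl, rfl⟩ := hneg hc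
        have hD : recDegree e j (n + 1) = e j + (recDegree e (j + 1) n + 1 / 2) := by
          simp only [recDegree, if_neg hgt.not_gt, if_neg hc]; ring
        have hC : recCoeff e j (n + 1) = 1 * -recCoeff e (j + 1) n := by
          simp only [recCoeff, if_neg (fun h => hc h.2 : ¬ (0 < e j ∧ 0 < n ∧ 0 < e (j + 1)))]
          ring
        rw [hD, hC]
        exact ⟨ht.add_of_lt hq (by linarith), _, _, hP', fun _ => by linarith,
          fun h => absurd ⟨n.succ_pos, hgt⟩ h⟩

/-- Both sides distribute the same half units over a run of positive entries, starting from opposite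
ends. The correction 1 occurs when the run containing e_{j+1} has begun before the range of
summation: then the sum has no entry with +1/2 for that run. -/
theorem sum_max_eq_recDegree (e : ℕ → ℤ) (n : ℕ) :
    ∀ j, (∀ i ∈ Finset.Ico (j + 1) (j + 1 + n), Even (e i) ∧ e i ≠ 0) → e j ≠ 0 →
      ∑ i ∈ Finset.Ico (j + 1) (j + 1 + n),
        max ((e i : ℚ) - ((e i * e (i - 1)).sign : ℚ) / 2) (-1 / 2) =
      recDegree e (j + 1) n - if 0 < e j ∧ 0 < n ∧ 0 < e (j + 1) then 1 else 0 := by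
  induction n with
  | zero => simp [recDegree]
  | succ n ih =>
    intro j he hj
    obtain ⟨hev, hne⟩ := he (j + 1) (by simp)
    have key := ih (j + 1) (fun i hi => he i (by simp at hi ⊢; omega)) hne
    rw [Finset.sum_eq_sum_Ico_succ_bot (by omega), show j + 1 + (n + 1) = j + 1 + 1 + n by ring,
      key, recDegree, Nat.add_sub_cancel, Int.sign_mul]
    rcases lt_or_gt_of_ne hne with hlt | hgt
    · have hle : (e (j + 1) : ℚ) ≤ -2 := by
        have : e (j + 1) ≤ -2 := by obtain ⟨k, hk⟩ := hev; omega
        exact_mod_cast this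
      rw [max_eq_right]
      · simp only [hlt, hlt.not_gt, if_true, false_and, and_false, if_false]
        ring
      · rcases lt_or_gt_of_ne hj with h | h
        · rw [Int.sign_eq_neg_one_of_neg hlt, Int.sign_eq_neg_one_of_neg h]; push_cast; linarith
        · rw [Int.sign_eq_neg_one_of_neg hlt, Int.sign_eq_one_of_pos h]; push_cast; linarith
    · have hge : (2 : ℚ) ≤ e (j + 1) := by
        have : 2 ≤ e (j + 1) := by obtain ⟨k, hk⟩ := hev; omega
        exact_mod_cast this
      rw [if_neg hgt.not_gt, Int.sign_eq_one_of_pos hgt]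
      rcases lt_or_gt_of_ne hj with h | h
      · rw [Int.sign_eq_neg_one_of_neg h, max_eq_left (by push_cast; linarith)]
        simp only [hgt, h.not_gt, true_and, false_and, if_false]
        split_ifs <;> push_cast <;> ring
      · rw [Int.sign_eq_one_of_pos h, max_eq_left (by push_cast; linarith)]
        simp only [hgt, h, n.succ_pos, true_and, and_true, if_true]
        split_ifs <;> push_cast <;> ring

theorem recCoeff_eq (e : ℕ → ℤ) (n : ℕ) :
    ∀ j, recCoeff e j n = (-1) ^ (n - ((Finset.Ico j (j + n - 1)).filter fun i =>
      0 < e i ∧ 0 < e (i + 1)).card) := by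
  -- This bound ensures that the subtraction in the exponent is not truncated.
  have hle : ∀ j n, ((Finset.Ico j (j + n - 1)).filter fun i =>
      0 < e i ∧ 0 < e (i + 1)).card ≤ n := fun j n =>
    (Finset.card_filter_le _ _).trans (by rw [Nat.card_Ico]; omega)
  induction n with
  | zero => simp [recCoeff]
  | succ n ih =>
    intro j
    rw [recCoeff, ih]
    rcases Nat.eq_zero_or_pos n with rfl | hn
    · simp
    have hl := hle (j + 1) n
    have hI : Finset.Ico j (j + (n + 1) - 1) = insert j (Finset.Ico (j + 1) (j + 1 + n - 1)) := by
      ext i; simp; omega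
    rw [hI, Finset.filter_insert]
    by_cases h : 0 < e j ∧ 0 < e (j + 1)
    · rw [if_pos ⟨h.1, hn, h.2⟩, if_pos h, Finset.card_insert_of_notMem (by simp), mul_one,
        Nat.add_sub_add_right]
    · rw [if_neg (fun h' => h ⟨h'.1, h'.2.2⟩), if_neg h, Nat.succ_sub hl, pow_succ]

/-! ### Closed curves of smoothed four-strand plats -/

/-- The two planar systems of caps on four strands. -/
def platCaps (l : Bool) : Fin 4 → Fin 4 := if l then ![1, 0, 3, 2] else ![3, 2, 1, 0]

/-- The plat diagram on four strands with a given word and given caps. -/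
def fourPlat (w : List (Fin 3 × Bool)) (l r : Bool) : LinkDiagram where
  n := 3
  word := w
  left := platCaps l
  right := platCaps r
  left_left := by revert l; decide
  left_ne := by revert l; decide
  left_planar := by revert l; decide
  right_right := by revert r; decide
  right_ne := by revert r; decide
  right_planar := by revert r; decide

section Loops

open LinkDiagram

variable {x : Fin 3 × Bool} {w : List (Fin 3 × Bool)} {l l' r : Bool}

/-- The restriction of a state to all crossings but the first. -/
def tailState (s : Fin (x :: w).length → Bool) : Fin w.length → Bool :=
  fun k => s (Fin.succ (n := w.length) k)

/-- The class of a point in the smoothed diagram. -/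
abbrev curve {w : List (Fin 3 × Bool)} {l r : Bool} (s : Fin w.length → Bool)
    (k : Fin (w.length + 1)) (ρ : Fin 4) : Quot ((fourPlat w l r).Arc s) :=
  Quot.mk _ (k, ρ)

theorem curve_capLeft (s : Fin w.length → Bool) (ρ : Fin 4) :
    (curve s 0 (platCaps l ρ) : Quot ((fourPlat w l r).Arc s)) = curve s 0 ρ :=
  (Quot.sound (Arc.capLeft (D := fourPlat w l r) (s := s) ρ)).symm

theorem curve_straight (s : Fin (x :: w).length → Bool) (ρ : Fin 4) (h1 : ρ ≠ x.1.castSucc)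
    (h2 : ρ ≠ x.1.succ) :
    (curve s 0 ρ : Quot ((fourPlat (x :: w) l r).Arc s)) = curve s (Fin.succ 0) ρ :=
  Quot.sound (Arc.straight (D := fourPlat (x :: w) l r) (s := s) (0 : Fin (w.length + 1)) ρ h1 h2)

theorem curve_turnLeft (s : Fin (x :: w).length → Bool)
    (h : s (0 : Fin (w.length + 1)) = x.2) :
    (curve s 0 x.1.castSucc : Quot ((fourPlat (x :: w) l r).Arc s)) = curve s 0 x.1.succ :=
  Quot.sound (Arc.turnLeft (D := fourPlat (x :: w) l r) (s := s) (0 : Fin (w.length + 1)) h)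

theorem curve_turnRight (s : Fin (x :: w).length → Bool)
    (h : s (0 : Fin (w.length + 1)) = x.2) :
    (curve s (Fin.succ 0) x.1.castSucc : Quot ((fourPlat (x :: w) l r).Arc s)) =
      curve s (Fin.succ 0) x.1.succ :=
  Quot.sound (Arc.turnRight (D := fourPlat (x :: w) l r) (s := s) (0 : Fin (w.length + 1)) h)

theorem curve_across (s : Fin (x :: w).length → Bool)
    (h : s (0 : Fin (w.length + 1)) ≠ x.2) (ρ : Fin 4) :
    (curve s 0 ρ : Quot ((fourPlat (x :: w) l r).Arc s)) = curve s (Fin.succ 0) ρ := by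
  by_cases h1 : ρ = x.1.castSucc
  · subst h1
    exact Quot.sound (Arc.acrossLow (D := fourPlat (x :: w) l r) (s := s)
      (0 : Fin (w.length + 1)) h)
  by_cases h2 : ρ = x.1.succ
  · subst h2
    exact Quot.sound (Arc.acrossHigh (D := fourPlat (x :: w) l r) (s := s)
      (0 : Fin (w.length + 1)) h)
  exact curve_straight s ρ h1 h2

/-- The map of curves induced by adding a column on the left. -/
def shiftCurve (s : Fin (x :: w).length → Bool)
    (hcap : ∀ ρ, (curve s (Fin.succ 0) ρ : Quot ((fourPlat (x :: w) l r).Arc s)) =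
      curve s (Fin.succ 0) (platCaps l' ρ)) :
    Quot ((fourPlat w l' r).Arc (tailState s)) → Quot ((fourPlat (x :: w) l r).Arc s) :=
  Quot.lift (fun p => curve s p.1.succ p.2) (by
    intro a b h
    cases h with
    | capLeft ρ => exact hcap ρ
    | capRight ρ => exact Quot.sound (Arc.capRight (D := fourPlat (x :: w) l r) (s := s) ρ)
    | straight k ρ hl hh =>
      exact Quot.sound (Arc.straight (D := fourPlat (x :: w) l r) (s := s) k.succ ρ hl hh)
    | turnLeft k h =>
      exact Quot.sound (Arc.turnLeft (D := fourPlat (x :: w) l r) (s := s) k.succ h)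
    | turnRight k h =>
      exact Quot.sound (Arc.turnRight (D := fourPlat (x :: w) l r) (s := s) k.succ h)
    | acrossLow k h =>
      exact Quot.sound (Arc.acrossLow (D := fourPlat (x :: w) l r) (s := s) k.succ h)
    | acrossHigh k h =>
      exact Quot.sound (Arc.acrossHigh (D := fourPlat (x :: w) l r) (s := s) k.succ h))

/-- Common frame for the three ways in which a first column can act: `ι` places the old curves and
`f₀` the points at the new left end. The hypotheses say that these respect all arcs and that `g` is
inverse to the resulting map. -/
theorem loops_cons_eq_card (s : Fin (x :: w).length → Bool) {Q : Type}
    (ι : Quot ((fourPlat w l' r).Arc (tailState s)) → Q) (f₀ : Fin 4 → Q)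
    (g : Q → Quot ((fourPlat (x :: w) l r).Arc s))
    (hcap : ∀ ρ, f₀ (platCaps l ρ) = f₀ ρ)
    (hstraight : ∀ ρ, ρ ≠ x.1.castSucc → ρ ≠ x.1.succ → f₀ ρ = ι (curve _ 0 ρ))
    (hturn : s (0 : Fin (w.length + 1)) = x.2 → f₀ x.1.castSucc = f₀ x.1.succ ∧
      ι (curve _ 0 x.1.castSucc) = ι (curve _ 0 x.1.succ))
    (hacross : s (0 : Fin (w.length + 1)) ≠ x.2 → f₀ x.1.castSucc = ι (curve _ 0 x.1.castSucc) ∧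
      f₀ x.1.succ = ι (curve _ 0 x.1.succ))
    (hgι : ∀ k ρ, g (ι (curve _ k ρ)) = curve s k.succ ρ) (hg₀ : ∀ ρ, g (f₀ ρ) = curve s 0 ρ)
    (hsurj : ∀ q, (∃ p, ι p = q) ∨ ∃ ρ, f₀ ρ = q) :
    (fourPlat (x :: w) l r).loops s = Nat.card Q := by
  let F : Quot ((fourPlat (x :: w) l r).Arc s) → Q :=
    Quot.lift (fun p => Fin.cases (motive := fun _ => Q) (f₀ p.2) (fun k => ι (curve _ k p.2)) p.1)
      (by
        intro a b h
        cases h with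
        | capLeft ρ => exact (hcap ρ).symm
        | capRight ρ =>
          exact congrArg ι (Quot.sound (Arc.capRight (D := fourPlat w l' r)
            (s := tailState s) ρ))
        | straight k ρ hl hh =>
          induction k using Fin.cases with
          | zero => exact hstraight ρ hl hh
          | succ k =>
            exact congrArg ι (Quot.sound (Arc.straight (D := fourPlat w l' r)
              (s := tailState s) k ρ hl hh))
        | turnLeft k h =>
          induction k using Fin.cases with
          | zero => exact (hturn h).1
          | succ k =>
            exact congrArg ι (Quot.sound (Arc.turnLeft (D := fourPlat w l' r)
              (s := tailState s) k h))
        | turnRight k h =>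
          induction k using Fin.cases with
          | zero => exact (hturn h).2
          | succ k =>
            exact congrArg ι (Quot.sound (Arc.turnRight (D := fourPlat w l' r)
              (s := tailState s) k h))
        | acrossLow k h =>
          induction k using Fin.cases with
          | zero => exact (hacross h).1
          | succ k =>
            exact congrArg ι (Quot.sound (Arc.acrossLow (D := fourPlat w l' r)
              (s := tailState s) k h))
        | acrossHigh k h =>
          induction k using Fin.cases with
          | zero => exact (hacross h).2
          | succ k =>
            exact congrArg ι (Quot.sound (Arc.acrossHigh (D := fourPlat w l' r)
              (s := tailState s) k h)))
  refine Nat.card_congr ⟨F, g, ?_, ?_⟩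
  · rintro ⟨k, ρ⟩
    induction k using Fin.cases with
    | zero => exact hg₀ ρ
    | succ k => exact hgι k ρ
  · intro q
    rcases hsurj q with ⟨⟨k, ρ⟩, rfl⟩ | ⟨ρ, rfl⟩
    · exact congrArg F (hgι k ρ)
    · exact congrArg F (hg₀ ρ)

theorem loops_cons_of_across (s : Fin (x :: w).length → Bool)
    (h : s (0 : Fin (w.length + 1)) ≠ x.2) :
    (fourPlat (x :: w) l r).loops s = (fourPlat w l r).loops (tailState s) :=
  loops_cons_eq_card (l' := l) s id (fun ρ => curve _ 0 ρ)
    (shiftCurve s fun ρ => by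
      rw [← curve_across s h, ← curve_across s h, curve_capLeft])
    (curve_capLeft _) (fun _ _ _ => rfl) (fun h' => absurd h' h) (fun _ => ⟨rfl, rfl⟩)
    (fun _ _ => rfl) (fun ρ => (curve_across s h ρ).symm) (fun q => .inl ⟨q, rfl⟩)

/-- The condition on `l` says that a cap joins the two rows of the crossing; with the left turn this
cap closes up to a separate circle. -/
theorem loops_cons_of_turn_of_cap (s : Fin (x :: w).length → Bool)
    (h : s (0 : Fin (w.length + 1)) = x.2) (hl : l = decide (x.1 ≠ 1)) :
    (fourPlat (x :: w) l r).loops s = (fourPlat w l r).loops (tailState s) + 1 := by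
  have hl1 : platCaps l x.1.castSucc = x.1.succ := by
    subst hl; generalize x.1 = i; revert i; decide
  have hl2 : platCaps l x.1.succ = x.1.castSucc := by
    subst hl; generalize x.1 = i; revert i; decide
  have hl3 : ∀ ρ, ρ ≠ x.1.castSucc → ρ ≠ x.1.succ →
      platCaps l ρ ≠ x.1.castSucc ∧ platCaps l ρ ≠ x.1.succ := by
    subst hl; generalize x.1 = i; revert i; decide
  have : Finite (Quot ((fourPlat w l r).Arc (tailState s))) :=
    Finite.of_surjective _ Quot.mk_surjective
  have hcap : ∀ ρ, (curve s (Fin.succ 0) ρ : Quot ((fourPlat (x :: w) l r).Arc s)) =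
      curve s (Fin.succ 0) (platCaps l ρ) := by
    intro ρ
    by_cases h1 : ρ = x.1.castSucc
    · rw [h1, hl1, curve_turnRight s h]
    by_cases h2 : ρ = x.1.succ
    · rw [h2, hl2, curve_turnRight s h]
    rw [← curve_straight s ρ h1 h2, ← curve_straight s _ (hl3 ρ h1 h2).1 (hl3 ρ h1 h2).2,
      curve_capLeft]
  -- The value `none` stands for the new circle.
  have key := loops_cons_eq_card (l' := l) (l := l) (r := r) s some
    (fun ρ => if ρ = x.1.castSucc ∨ ρ = x.1.succ then none else some (curve _ 0 ρ))
    (fun q => q.elim (curve s 0 x.1.castSucc) (shiftCurve s hcap)) ?_ ?_ ?_ ?_ ?_ ?_ ?_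
  · rw [key, Finite.card_option]; rfl
  · intro ρ
    by_cases h1 : ρ = x.1.castSucc
    · simp [h1, hl1]
    by_cases h2 : ρ = x.1.succ
    · simp [h2, hl2]
    simp only [h1, h2, (hl3 ρ h1 h2).1, (hl3 ρ h1 h2).2, or_self, if_false]
    exact congrArg some (curve_capLeft _ ρ)
  · intro ρ h1 h2
    simp [h1, h2]
  · refine fun _ => ⟨by simp, ?_⟩
    exact congrArg some ((curve_capLeft (tailState s) _).symm.trans
      (congrArg (curve (tailState s) 0) hl1))
  · exact fun h' => absurd h h'
  · exact fun _ _ => rfl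
  · intro ρ
    by_cases h1 : ρ = x.1.castSucc
    · simp [h1]
    by_cases h2 : ρ = x.1.succ
    · simpa [h2] using curve_turnLeft s h
    simp only [h1, h2, or_self, if_false]
    exact (curve_straight s ρ h1 h2).symm
  · rintro (_ | q)
    · exact .inr ⟨x.1.castSucc, by simp⟩
    · exact .inl ⟨q, rfl⟩

/-- The left turn connects the two caps into one arc between the other two rows, and the right turn
is a cap on the crossing's rows; together they form the other system of caps. -/
theorem loops_cons_of_turn_of_not_cap (s : Fin (x :: w).length → Bool)
    (h : s (0 : Fin (w.length + 1)) = x.2) (hl : l ≠ decide (x.1 ≠ 1)) :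
    (fourPlat (x :: w) l r).loops s = (fourPlat w (!l) r).loops (tailState s) := by
  obtain rfl : l = decide (x.1 = 1) := by
    revert hl; generalize x.1 = i; revert i l; decide
  set l := decide (x.1 = 1) with hdef
  have hn1 : platCaps (!l) x.1.castSucc = x.1.succ := by
    rw [hdef]; generalize x.1 = i; revert i; decide
  have hn2 : platCaps (!l) x.1.succ = x.1.castSucc := by
    rw [hdef]; generalize x.1 = i; revert i; decide
  have hn3 : platCaps (!l) (platCaps l x.1.castSucc) = platCaps l x.1.succ := by
    rw [hdef]; generalize x.1 = i; revert i; decide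
  have h3 : ∀ ρ, ρ ≠ x.1.castSucc → ρ ≠ x.1.succ →
      (platCaps l ρ = x.1.castSucc ∧ platCaps (!l) ρ = platCaps l x.1.succ) ∨
      (platCaps l ρ = x.1.succ ∧ platCaps (!l) ρ = platCaps l x.1.castSucc) := by
    rw [hdef]; generalize x.1 = i; revert i; decide
  have h4 : (platCaps l x.1.castSucc ≠ x.1.castSucc ∧ platCaps l x.1.castSucc ≠ x.1.succ) ∧
      platCaps l x.1.succ ≠ x.1.castSucc ∧ platCaps l x.1.succ ≠ x.1.succ := by
    rw [hdef]; generalize x.1 = i; revert i; decide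
  have h5 : ∀ ρ, platCaps l (platCaps l ρ) = ρ := by
    generalize l = l; revert l; decide
  obtain ⟨⟨h41, h42⟩, h43, h44⟩ := h4
  have hcap : ∀ ρ, (curve s (Fin.succ 0) ρ : Quot ((fourPlat (x :: w) l r).Arc s)) =
      curve s (Fin.succ 0) (platCaps (!l) ρ) := by
    intro ρ
    by_cases h1 : ρ = x.1.castSucc
    · rw [h1, hn1, curve_turnRight s h]
    by_cases h2 : ρ = x.1.succ
    · rw [h2, hn2, curve_turnRight s h]
    rw [← curve_straight s ρ h1 h2, ← curve_capLeft]
    rcases h3 ρ h1 h2 with ⟨h31, h32⟩ | ⟨h31, h32⟩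
    · rw [h31, h32, ← curve_straight s _ h43 h44, curve_capLeft, curve_turnLeft s h]
    · rw [h31, h32, ← curve_straight s _ h41 h42, curve_capLeft, curve_turnLeft s h]
  -- A left end of the crossing is followed through its cap to a row that passes straight into the
  -- old diagram.
  refine loops_cons_eq_card (l' := !l) (l := l) (r := r) s id
    (fun ρ => if ρ = x.1.castSucc ∨ ρ = x.1.succ then curve _ 0 (platCaps l ρ) else curve _ 0 ρ)
    (shiftCurve s hcap) ?_ ?_ ?_ ?_ ?_ ?_ ?_
  · intro ρ
    by_cases h1 : ρ = x.1.castSucc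
    · simp [h1, h41, h42]
    by_cases h2 : ρ = x.1.succ
    · simp [h2, h43, h44]
    have : platCaps l ρ = x.1.castSucc ∨ platCaps l ρ = x.1.succ := (h3 ρ h1 h2).imp And.left And.left
    simp only [h1, h2, this, or_self, if_false, if_true, h5]
  · intro ρ h1 h2
    simp [h1, h2]
  · intro _
    simp only [true_or, or_true, if_true, id]
    exact ⟨(curve_capLeft (tailState s) _).symm.trans (congrArg (curve (tailState s) 0) hn3),
      (curve_capLeft (tailState s) _).symm.trans (congrArg (curve (tailState s) 0) hn1)⟩
  · exact fun h' => absurd h h'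
  · exact fun _ _ => rfl
  · intro ρ
    by_cases h1 : ρ = x.1.castSucc
    · simp only [h1, true_or, if_true]
      exact (curve_straight s _ h41 h42).symm.trans (curve_capLeft _ _)
    by_cases h2 : ρ = x.1.succ
    · simp only [h2, or_true, if_true]
      exact (curve_straight s _ h43 h44).symm.trans (curve_capLeft _ _)
    simp only [h1, h2, or_self, if_false]
    exact (curve_straight s ρ h1 h2).symm
  · exact fun q => .inl ⟨q, rfl⟩

end Loops

/-! ### The bracket of a plat: skein relation and empty words -/

/-- The weight of a smoothing in the Kauffman bracket. -/
noncomputable def smoothWeight (c : Bool) : FracPoly := if c then tPow (-1 / 4) else tPow (1 / 4)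

/-- The value of a closed curve in the Kauffman bracket. -/
noncomputable def loopValue : FracPoly := -tPow (-1 / 2) - tPow (1 / 2)

theorem bracket_eq (w : List (Fin 3 × Bool)) (l r : Bool) :
    (fourPlat w l r).bracket = ∑ s : Fin w.length → Bool,
      (∏ k, smoothWeight (s k)) * loopValue ^ ((fourPlat w l r).loops s - 1) := rfl

theorem loops_fourPlat_pos (w : List (Fin 3 × Bool)) (l r : Bool) (s : Fin w.length → Bool) :
    0 < (fourPlat w l r).loops s := by
  have : Finite (Quot ((fourPlat w l r).Arc s)) := Finite.of_surjective _ Quot.mk_surjective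
  have : Nonempty (Quot ((fourPlat w l r).Arc s)) := ⟨curve s 0 0⟩
  exact Nat.card_pos

/-- The state sum is split by the smoothing of the first crossing: `x.2` gives the turns, `!x.2` the
horizontal arcs. -/
theorem bracket_cons (x : Fin 3 × Bool) (w : List (Fin 3 × Bool)) (l r : Bool) :
    (fourPlat (x :: w) l r).bracket =
      smoothWeight x.2 * (if l = decide (x.1 ≠ 1) then loopValue * (fourPlat w l r).bracket
        else (fourPlat w (!l) r).bracket) + smoothWeight (!x.2) * (fourPlat w l r).bracket := by
  have key : (fourPlat (x :: w) l r).bracket = ∑ c : Bool, ∑ s : Fin w.length → Bool,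
      smoothWeight c * (∏ k, smoothWeight (s k)) * loopValue ^ ((fourPlat (x :: w) l r).loops
        (Fin.cons c s : Fin (w.length + 1) → Bool) - 1) := by
    rw [bracket_eq, ← Fintype.sum_prod_type' (f := fun (c : Bool) (s : Fin w.length → Bool) =>
      smoothWeight c * (∏ k, smoothWeight (s k)) * loopValue ^ ((fourPlat (x :: w) l r).loops
        (Fin.cons c s : Fin (w.length + 1) → Bool) - 1))]
    refine (Fintype.sum_equiv (Fin.consEquiv fun _ : Fin (w.length + 1) => Bool) _ _ ?_).symm
    rintro ⟨c, s⟩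
    have : ∏ k : Fin (w.length + 1), smoothWeight ((Fin.cons c s : Fin (w.length + 1) → Bool) k) =
        smoothWeight c * ∏ k, smoothWeight (s k) := by
      rw [Fin.prod_univ_succ]; rfl
    exact congrArg (· * _) this.symm
  have split : ∀ f : Bool → FracPoly, ∑ c, f c = f x.2 + f (!x.2) := by
    intro f
    cases x.2 <;> simp [add_comm]
  rw [key, split]
  congr 1
  · split_ifs with hl
    · rw [bracket_eq, Finset.mul_sum, Finset.mul_sum]
      refine Finset.sum_congr rfl fun s _ => ?_
      rw [loops_cons_of_turn_of_cap _ rfl hl]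
      obtain ⟨n, hn⟩ := Nat.exists_eq_succ_of_ne_zero (loops_fourPlat_pos w l r s).ne'
      have : (fourPlat w l r).loops (tailState (x := x) (Fin.cons x.2 s : Fin (w.length + 1) → Bool))
        = n + 1 := hn
      rw [this, hn, Nat.succ_sub_one, Nat.succ_sub_one, pow_succ]
      ring
    · rw [bracket_eq, Finset.mul_sum]
      refine Finset.sum_congr rfl fun s _ => ?_
      rw [loops_cons_of_turn_of_not_cap _ rfl hl, mul_assoc]
      rfl
  · rw [bracket_eq, Finset.mul_sum]
    refine Finset.sum_congr rfl fun s _ => ?_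
    rw [loops_cons_of_across _ (by simp), mul_assoc]
    rfl

theorem loops_nil_of_eq (l : Bool) (s : Fin 0 → Bool) : (fourPlat [] l l).loops s = 2 := by
  -- A colouring constant on caps; rows 0 and 2 represent the two circles for either `l`.
  let c : Fin 4 → Bool := ![true, l, false, !l]
  have hc : ∀ ρ, c ρ = c (platCaps l ρ) := by revert l; decide
  have hc' : ∀ ρ : Fin 4, (if c ρ then 0 else 2) = ρ ∨ platCaps l (if c ρ then 0 else 2) = ρ := by
    clear hc; revert l; decide
  have hc'' : ∀ u : Bool, c (if u then 0 else 2) = u := by clear hc hc'; revert l; decide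
  let pt (ρ : Fin 4) : Quot ((fourPlat [] l l).Arc s) := Quot.mk _ ((0 : Fin 1), ρ)
  have hl : ∀ ρ, pt (platCaps l ρ) = pt ρ := fun ρ =>
    (Quot.sound (LinkDiagram.Arc.capLeft (D := fourPlat [] l l) (s := s) ρ)).symm
  let F : Quot ((fourPlat [] l l).Arc s) → Bool := Quot.lift (fun p => c p.2) (by
    intro a b h
    cases h with
    | capLeft ρ => exact hc ρ
    | capRight ρ => exact hc ρ
    | straight k => exact k.elim0
    | turnLeft k => exact k.elim0
    | turnRight k => exact k.elim0
    | acrossLow k => exact k.elim0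
    | acrossHigh k => exact k.elim0)
  have hcard : (fourPlat [] l l).loops s = Nat.card Bool := by
    refine Nat.card_congr ⟨F, fun u => pt (if u then 0 else 2), ?_, hc''⟩
    rintro ⟨k, ρ⟩
    obtain rfl : k = (0 : Fin 1) := Subsingleton.elim (α := Fin 1) _ _
    rcases hc' ρ with h | h
    · exact congrArg pt h
    · exact (hl _).symm.trans (congrArg pt h)
  rw [hcard, Nat.card_eq_fintype_card, Fintype.card_bool]

theorem loops_nil_of_ne {l r : Bool} (h : l ≠ r) (s : Fin 0 → Bool) :
    (fourPlat [] l r).loops s = 1 := by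
  have h1 : ∀ ρ : Fin 4, ρ = 0 ∨ ρ = platCaps l 0 ∨ ρ = platCaps r 0 ∨
      ρ = platCaps r (platCaps l 0) := by
    revert l r; decide
  let pt (ρ : Fin 4) : Quot ((fourPlat [] l r).Arc s) := Quot.mk _ ((0 : Fin 1), ρ)
  have hl : ∀ ρ, pt (platCaps l ρ) = pt ρ := fun ρ =>
    (Quot.sound (LinkDiagram.Arc.capLeft (D := fourPlat [] l r) (s := s) ρ)).symm
  have hr : ∀ ρ, pt (platCaps r ρ) = pt ρ := fun ρ =>
    (Quot.sound (LinkDiagram.Arc.capRight (D := fourPlat [] l r) (s := s) ρ)).symm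
  have h0 : ∀ ρ, pt ρ = pt 0 := by
    intro ρ
    rcases h1 ρ with rfl | rfl | rfl | rfl
    · rfl
    · exact hl 0
    · exact hr 0
    · exact (hr _).trans (hl 0)
  refine Nat.card_eq_one_iff_unique.2 ⟨⟨?_⟩, ⟨pt 0⟩⟩
  rintro ⟨k, ρ⟩ ⟨k', ρ'⟩
  obtain rfl : k = (0 : Fin 1) := Subsingleton.elim (α := Fin 1) _ _
  obtain rfl : k' = (0 : Fin 1) := Subsingleton.elim (α := Fin 1) _ _
  exact (h0 ρ).trans (h0 ρ').symm

theorem bracket_nil_of_eq (l : Bool) : (fourPlat [] l l).bracket = loopValue := by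
  rw [bracket_eq]
  refine (Finset.sum_congr rfl fun s _ => by rw [loops_nil_of_eq]).trans ?_
  simp

theorem bracket_nil_of_ne {l r : Bool} (h : l ≠ r) : (fourPlat [] l r).bracket = 1 := by
  rw [bracket_eq]
  refine (Finset.sum_congr rfl fun s _ => by rw [loops_nil_of_ne h]).trans ?_
  simp

theorem tPow_pow (q : ℚ) (n : ℕ) : tPow q ^ n = tPow (n * q) := by
  simp [tPow, AddMonoidAlgebra.single_pow]

/-- The sign `1` or `-1` encoded by a Boolean. -/
def boolSign (u : Bool) : ℤ := if u then 1 else -1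

theorem smoothWeight_mul (u : Bool) : smoothWeight u * smoothWeight (!u) = 1 := by
  cases u <;> simp [smoothWeight, tPow_mul_tPow] <;> norm_num [tPow_zero]

theorem loopValue_eq (u : Bool) :
    loopValue = -smoothWeight u ^ 2 - smoothWeight (!u) ^ 2 := by
  cases u <;> simp [smoothWeight, tPow_pow, loopValue] <;> norm_num [sub_eq_add_neg, add_comm]

theorem smoothWeight_not_pow (u : Bool) (n : ℕ) :
    smoothWeight (!u) ^ n = tPow (n * boolSign u / 4) := by
  cases u <;> simp [smoothWeight, tPow_pow, boolSign] <;> ring_nf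

/-! ### Brackets of twists with an even number of crossings -/

section Twist

variable (i : Fin 3) (u : Bool) (w : List (Fin 3 × Bool)) (r : Bool)

/-- A crossing next to a cap on its rows is a curl, as in the first Reidemeister move. -/
theorem bracket_cons_of_cap :
    (fourPlat ((i, u) :: w) (decide (i ≠ 1)) r).bracket =
      -smoothWeight u ^ 3 * (fourPlat w (decide (i ≠ 1)) r).bracket := by
  rw [bracket_cons, if_pos rfl, loopValue_eq u]
  linear_combination (-smoothWeight (!u) * (fourPlat w (decide (i ≠ 1)) r).bracket) *
    smoothWeight_mul u

theorem bracket_cons_of_not_cap :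
    (fourPlat ((i, u) :: w) (!decide (i ≠ 1)) r).bracket =
      smoothWeight u * (fourPlat w (decide (i ≠ 1)) r).bracket +
        smoothWeight (!u) * (fourPlat w (!decide (i ≠ 1)) r).bracket := by
  rw [bracket_cons, if_neg (by simp), Bool.not_not]

theorem bracket_cons_cons_of_cap :
    tPow (3 * boolSign u / 2) *
      (fourPlat ((i, u) :: (i, u) :: w) (decide (i ≠ 1)) r).bracket =
        (fourPlat w (decide (i ≠ 1)) r).bracket := by
  have h6 : tPow (3 * boolSign u / 2) = smoothWeight (!u) ^ 6 := by
    rw [smoothWeight_not_pow]; congr 1; push_cast; ring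
  have h1 : (smoothWeight u * smoothWeight (!u)) ^ 6 = 1 := by rw [smoothWeight_mul, one_pow]
  rw [bracket_cons_of_cap, bracket_cons_of_cap, h6]
  linear_combination (fourPlat w (decide (i ≠ 1)) r).bracket * h1

theorem bracket_cons_cons_of_not_cap :
    tPow (3 * boolSign u / 2) *
      (fourPlat ((i, u) :: (i, u) :: w) (!decide (i ≠ 1)) r).bracket =
        tPow (2 * boolSign u) * (fourPlat w (!decide (i ≠ 1)) r).bracket +
        (tPow (3 * boolSign u / 2) - tPow (boolSign u / 2)) *
          (fourPlat w (decide (i ≠ 1)) r).bracket := by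
  have h6 : tPow (3 * boolSign u / 2) = smoothWeight (!u) ^ 6 := by
    rw [smoothWeight_not_pow]; congr 1; push_cast; ring
  have h8 : tPow (2 * boolSign u) = smoothWeight (!u) ^ 8 := by
    rw [smoothWeight_not_pow]; congr 1; push_cast; ring
  have h2 : tPow (boolSign u / 2) = smoothWeight (!u) ^ 2 := by
    rw [smoothWeight_not_pow]; congr 1; push_cast; ring
  have h1 := smoothWeight_mul u
  have h4 : (smoothWeight u * smoothWeight (!u)) ^ 4 = 1 := by rw [smoothWeight_mul, one_pow]
  rw [bracket_cons_of_not_cap, bracket_cons_of_not_cap, bracket_cons_of_cap, h6, h8, h2]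
  linear_combination (fourPlat w (decide (i ≠ 1)) r).bracket *
    (smoothWeight (!u) ^ 6 * h1 - smoothWeight (!u) ^ 2 * h4)

theorem bracket_twist_of_cap (k : ℕ) :
    tPow (3 * boolSign u * k / 2) *
      (fourPlat (List.replicate (2 * k) (i, u) ++ w) (decide (i ≠ 1)) r).bracket =
        (fourPlat w (decide (i ≠ 1)) r).bracket := by
  induction k with
  | zero => simp [tPow_zero]
  | succ k ih =>
    have hl : List.replicate (2 * (k + 1)) (i, u) ++ w =
      (i, u) :: (i, u) :: (List.replicate (2 * k) (i, u) ++ w) := rfl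
    have ht : tPow (3 * boolSign u * (k + 1 : ℕ) / 2) =
        tPow (3 * boolSign u * k / 2) * tPow (3 * boolSign u / 2) := by
      rw [tPow_mul_tPow]; congr 1; push_cast; ring
    rw [hl, ht, mul_assoc, bracket_cons_cons_of_cap, ih]

/-- The power of t cancels the curl factors: it is 3/4 of the signed number of crossings. -/
theorem bracket_twist_of_not_cap (k : ℕ) :
    tPow (3 * boolSign u * k / 2) *
      (fourPlat (List.replicate (2 * k) (i, u) ++ w) (!decide (i ≠ 1)) r).bracket =
        tPow (2 * boolSign u * k) * (fourPlat w (!decide (i ≠ 1)) r).bracket +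
        geomTPow (boolSign u) k * (tPow (3 * boolSign u / 2) - tPow (boolSign u / 2)) *
          (fourPlat w (decide (i ≠ 1)) r).bracket := by
  induction k with
  | zero => simp [tPow_zero, geomTPow]
  | succ k ih =>
    have hl : List.replicate (2 * (k + 1)) (i, u) ++ w =
      (i, u) :: (i, u) :: (List.replicate (2 * k) (i, u) ++ w) := rfl
    have ht : tPow (3 * boolSign u * (k + 1 : ℕ) / 2) =
        tPow (3 * boolSign u * k / 2) * tPow (3 * boolSign u / 2) := by
      rw [tPow_mul_tPow]; congr 1; push_cast; ring
    have ht' : tPow (2 * boolSign u * (k + 1 : ℕ)) =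
        tPow (2 * boolSign u) * tPow (2 * boolSign u * k) := by
      rw [tPow_mul_tPow]; congr 1; push_cast; ring
    have hg : geomTPow (boolSign u) (k + 1) = 1 + tPow (2 * boolSign u) * geomTPow (boolSign u) k := by
      rw [geomTPow, Finset.sum_range_succ', geomTPow, Finset.mul_sum, add_comm]
      simp only [tPow_mul_tPow]
      congr 1
      · simp [tPow_zero]
      · refine Finset.sum_congr rfl fun j _ => ?_
        congr 1; push_cast; ring
    have hc := bracket_twist_of_cap i u w r k
    rw [hl, ht, mul_assoc, bracket_cons_cons_of_not_cap, hg, ht']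
    linear_combination tPow (2 * boolSign u) * ih +
      (tPow (3 * boolSign u / 2) - tPow (boolSign u / 2)) * hc

end Twist

/-! ### The recursion for two-bridge brackets -/

/-- The Boolean index of the system of caps that joins the rows of the `j`-th twist. -/
def twistCap (j : ℕ) : Bool := decide ((if Odd j then 1 else 0 : Fin 3) ≠ 1)

theorem twistCap_eq (j : ℕ) : twistCap j = !decide (Odd j) := by
  by_cases h : Odd j <;> simp [twistCap, h]

theorem twistCap_succ (j : ℕ) : twistCap (j + 1) = !twistCap j := by
  rw [twistCap_eq, twistCap_eq]
  by_cases h : Odd j <;> simp [Nat.odd_add_one, h]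

/-- The crossings of the `n` twists with signed numbers of crossings `e j, …, e (j + n - 1)`. -/
def twistWord (e : ℕ → ℤ) (j n : ℕ) : List (Fin 3 × Bool) :=
  (List.range' j n).flatMap fun i =>
    List.replicate (e i).natAbs (if Odd i then 1 else 0, decide (0 < e i))

theorem twistWord_zero (e : ℕ → ℤ) (j : ℕ) : twistWord e j 0 = [] := rfl

theorem twistWord_succ (e : ℕ → ℤ) (j n : ℕ) : twistWord e j (n + 1) =
    List.replicate (e j).natAbs (if Odd j then 1 else 0, decide (0 < e j)) ++
      twistWord e (j + 1) n := by
  rw [twistWord, List.range'_succ, List.flatMap_cons]; rfl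

theorem boolSign_decide {e : ℤ} (he : e ≠ 0) : boolSign (decide (0 < e)) = e.sign := by
  rcases lt_or_gt_of_ne he with h | h
  · simp [boolSign, h.not_gt, Int.sign_eq_neg_one_of_neg h]
  · simp [boolSign, h, Int.sign_eq_one_of_pos h]

theorem exists_natAbs_eq_two_mul {e : ℤ} (he : Even e) :
    ∃ k : ℕ, e.natAbs = 2 * k ∧ e.sign * (2 * k) = e := by
  obtain ⟨k, hk⟩ := he
  refine ⟨k.natAbs, by omega, ?_⟩
  have : (2 * (k.natAbs : ℤ)) = e.natAbs := by omega
  rw [this, Int.sign_mul_natAbs]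

/-- The bracket of the diagram of the twists `e j, …, e (j + n - 1)`, normalized by a power of `t`
so that the last twist is closed as in a two-bridge link with `m` twists. -/
noncomputable def twistBracket (e : ℕ → ℤ) (m : ℕ) (l : Bool) (j n : ℕ) : FracPoly :=
  tPow (3 * (∑ i ∈ Finset.Ico j (j + n), e i : ℤ) / 4) *
    (fourPlat (twistWord e j n) l (decide (Odd m))).bracket

theorem twistBracket_succ {e : ℕ → ℤ} (m : ℕ) {j : ℕ} (hev : Even (e j)) (hne : e j ≠ 0) (n : ℕ) :
    twistBracket e m (twistCap j) j (n + 1) = twistBracket e m (twistCap j) (j + 1) n ∧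
    twistBracket e m (!twistCap j) j (n + 1) =
      tPow (e j) * twistBracket e m (!twistCap j) (j + 1) n +
        twistQuot (e j) * twistBracket e m (twistCap j) (j + 1) n := by
  obtain ⟨k, hk, hsk⟩ := exists_natAbs_eq_two_mul hev
  have hk2 : (e j).natAbs / 2 = k := by omega
  have hq : ((e j).sign : ℚ) * (2 * k) = e j := by exact_mod_cast hsk
  have ht : tPow (3 * (∑ i ∈ Finset.Ico j (j + (n + 1)), e i : ℤ) / 4) =
      tPow (3 * (∑ i ∈ Finset.Ico (j + 1) (j + 1 + n), e i : ℤ) / 4) *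
        tPow (3 * (e j).sign * k / 2) := by
    rw [tPow_mul_tPow, Finset.sum_eq_sum_Ico_succ_bot (by omega),
      show j + (n + 1) = j + 1 + n by ring]
    congr 1
    push_cast
    linear_combination (-3 / 4 : ℚ) * hq
  have h1 := bracket_twist_of_cap (if Odd j then 1 else 0) (decide (0 < e j))
    (twistWord e (j + 1) n) (decide (Odd m)) k
  have h2 := bracket_twist_of_not_cap (if Odd j then 1 else 0) (decide (0 < e j))
    (twistWord e (j + 1) n) (decide (Odd m)) k
  have ht2 : tPow (2 * (e j).sign * k) = tPow (e j) := by
    congr 1; linear_combination hq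
  rw [boolSign_decide hne, ← hk, ← twistCap, ← twistWord_succ] at h1 h2
  rw [ht2] at h2
  simp only [twistBracket, twistQuot, hk2]
  rw [ht]
  constructor
  · linear_combination tPow (3 * (∑ i ∈ Finset.Ico (j + 1) (j + 1 + n), e i : ℤ) / 4) * h1
  · linear_combination tPow (3 * (∑ i ∈ Finset.Ico (j + 1) (j + 1 + n), e i : ℤ) / 4) * h2

theorem hasLead_twistBracket {e : ℕ → ℤ} {m : ℕ}
    (he : ∀ i, 1 ≤ i → i ≤ m → Even (e i) ∧ e i ≠ 0) :
    HasLead (twistBracket e m true 1 m) (recDegree e 1 m) (recCoeff e 1 m) := by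
  -- The right caps are those joining the rows of a fictitious twist m + 1, so the empty word yields
  -- two circles for Q and one for P.
  have hm : twistCap (m + 1) = decide (Odd m) := by simp [twistCap_succ, twistCap_eq]
  have := hasLead_of_recursion (m := m) (P := fun j n => twistBracket e m (!twistCap j) j n)
    (Q := fun j n => twistBracket e m (twistCap j) j n) he ?_ ?_ ?_ ?_ m 1 le_rfl (by omega)
  · simpa [twistCap] using this
  · simp [twistBracket, twistWord_zero, hm, tPow_zero,
      bracket_nil_of_ne (l := !decide (Odd m)) (r := decide (Odd m)) (by simp)]
  · simp only [twistBracket, twistWord_zero, hm, bracket_nil_of_eq]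
    simp [tPow_zero, loopValue]
  · intro j n h1 h2
    obtain ⟨hev, hne⟩ := he j h1 (by omega)
    simpa only [twistCap_succ, Bool.not_not] using (twistBracket_succ m hev hne n).2
  · intro j n h1 h2
    obtain ⟨hev, hne⟩ := he j h1 (by omega)
    simpa only [twistCap_succ, Bool.not_not] using (twistBracket_succ m hev hne n).1

/-! ### Orientations and the writhe -/

/-- The transposition of rows effected by a crossing. -/
abbrev crossSwap (x : Fin 3 × Bool) : Equiv.Perm (Fin 4) := Equiv.swap x.1.castSucc x.1.succ

/-- The sign of a crossing whose left ends are directed according to `c`. -/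
def crossSign (x : Fin 3 × Bool) (c : Fin 4 → Bool) : ℤ :=
  if x.2 = (c x.1.castSucc != c x.1.succ) then 1 else -1

/-- The directions at the position `k` of a word whose left ends are directed according to `c`. -/
def wordDir (c : Fin 4 → Bool) : List (Fin 3 × Bool) → ℕ → Fin 4 → Bool
  | _, 0 => c
  | [], _ + 1 => c
  | x :: w, k + 1 => wordDir (c ∘ crossSwap x) w k

/-- The writhe of a word whose left ends are directed according to `c`. -/
def wordWrithe (c : Fin 4 → Bool) : List (Fin 3 × Bool) → ℤ
  | [] => 0
  | x :: w => crossSign x c + wordWrithe (c ∘ crossSwap x) w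

theorem wordDir_zero (c : Fin 4 → Bool) (w : List (Fin 3 × Bool)) : wordDir c w 0 = c := by
  cases w <;> rfl

theorem wordDir_succ (w : List (Fin 3 × Bool)) : ∀ (c : Fin 4 → Bool) (k : Fin w.length)
    (ρ : Fin 4), wordDir c w (k + 1) (crossSwap (w.get k) ρ) = wordDir c w k ρ := by
  induction w with
  | nil => exact fun _ k => k.elim0
  | cons x w ih =>
    intro c k ρ
    induction k using Fin.cases with
    | zero => simp [wordDir]
    | succ k => exact ih _ k ρ

theorem comp_crossSwap_comp (x : Fin 3 × Bool) (c : Fin 4 → Bool) :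
    (c ∘ crossSwap x) ∘ crossSwap x = c := by
  ext ρ; simp

theorem wordDir_twist (c : Fin 4 → Bool) (x : Fin 3 × Bool) (w : List (Fin 3 × Bool)) (k : ℕ) :
    wordDir c (List.replicate (2 * k) x ++ w) (List.replicate (2 * k) x ++ w).length =
      wordDir c w w.length := by
  induction k with
  | zero => rfl
  | succ k ih =>
    rw [← ih]
    exact congrArg (fun c => wordDir c _ _) (comp_crossSwap_comp x c)

theorem wordDir_twistWord {e : ℕ → ℤ} (c : Fin 4 → Bool) (n : ℕ) : ∀ j,
    (∀ i, j ≤ i → i < j + n → Even (e i)) →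
      wordDir c (twistWord e j n) (twistWord e j n).length = c := by
  induction n with
  | zero => exact fun _ _ => rfl
  | succ n ih =>
    intro j he
    obtain ⟨k, hk, -⟩ := exists_natAbs_eq_two_mul (he j le_rfl (by omega))
    rw [twistWord_succ, hk, wordDir_twist, ih _ fun i h1 h2 => he i (by omega) (by omega)]

theorem crossSign_of_ne {c : Fin 4 → Bool} {i : Fin 3} (h : c i.castSucc ≠ c i.succ) (u : Bool) :
    crossSign (i, u) c = boolSign u := by
  simp [crossSign, boolSign, bne_iff_ne.2 h]

/-- Exchanging two antiparallel strands leaves them antiparallel, and two exchanges restore `c`. -/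
theorem wordWrithe_twist {c : Fin 4 → Bool} {i : Fin 3} (h : c i.castSucc ≠ c i.succ) (u : Bool)
    (w : List (Fin 3 × Bool)) (k : ℕ) :
    wordWrithe c (List.replicate (2 * k) (i, u) ++ w) = boolSign u * (2 * k) + wordWrithe c w := by
  induction k with
  | zero => simp
  | succ k ih =>
    have hl : List.replicate (2 * (k + 1)) (i, u) ++ w =
      (i, u) :: (i, u) :: (List.replicate (2 * k) (i, u) ++ w) := rfl
    have h' : (c ∘ crossSwap (i, u)) i.castSucc ≠ (c ∘ crossSwap (i, u)) i.succ := by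
      simpa using h.symm
    rw [hl, wordWrithe, wordWrithe, comp_crossSwap_comp, ih, crossSign_of_ne h, crossSign_of_ne h']
    push_cast; ring

theorem wordWrithe_twistWord {e : ℕ → ℤ} {c : Fin 4 → Bool}
    (hc : ∀ i : Fin 3, c i.castSucc ≠ c i.succ) (n : ℕ) : ∀ j,
    (∀ i, j ≤ i → i < j + n → Even (e i) ∧ e i ≠ 0) →
      wordWrithe c (twistWord e j n) = ∑ i ∈ Finset.Ico j (j + n), e i := by
  induction n with
  | zero => intro j _; simp [twistWord_zero, wordWrithe]
  | succ n ih =>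
    intro j he
    obtain ⟨hev, hne⟩ := he j le_rfl (by omega)
    obtain ⟨k, hk, hsk⟩ := exists_natAbs_eq_two_mul hev
    rw [twistWord_succ, hk, wordWrithe_twist (hc _), boolSign_decide hne, hsk,
      ih _ fun i h1 h2 => he i (by omega) (by omega),
      Finset.sum_eq_sum_Ico_succ_bot (by omega : j < j + (n + 1)),
      show j + (n + 1) = j + 1 + n by ring]

/-- The directions at the left end propagate through every crossing and so determine all signs. -/
theorem sum_crossSign (w : List (Fin 3 × Bool)) : ∀ (dir : Fin (w.length + 1) → Fin 4 → Bool),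
    (∀ (k : Fin w.length) (ρ : Fin 4), dir k.succ (crossSwap (w.get k) ρ) = dir k.castSucc ρ) →
      ∑ k : Fin w.length, crossSign (w.get k) (dir k.castSucc) = wordWrithe (dir 0) w := by
  induction w with
  | nil => intro _ _; rfl
  | cons x w ih =>
    intro dir h
    have h0 : dir (Fin.succ (0 : Fin (w.length + 1))) = dir 0 ∘ crossSwap x := by
      ext ρ
      have := h (0 : Fin (w.length + 1)) (crossSwap x ρ)
      simpa using this
    rw [wordWrithe, ← h0]
    refine (Fin.sum_univ_succ (n := w.length) _).trans ?_
    exact congrArg (_ + ·) (ih (fun k => dir k.succ) fun k ρ => h k.succ ρ)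

/-! ### Two-bridge diagrams -/

section TwoBridge

variable (m : ℕ) (b : ℕ → ℤ)

/-- The signed number of crossings of the `i`-th twist of a two-bridge diagram; its sign is the
`i`-th entry of the type sequence. -/
def twistExponent (i : ℕ) : ℤ := (-1) ^ (i + 1) * b i

theorem twistExponent_of_odd {i : ℕ} (h : Odd i) : twistExponent b i = b i := by
  rw [twistExponent, h.add_one.neg_one_pow, one_mul]

theorem twistExponent_of_not_odd {i : ℕ} (h : ¬ Odd i) : twistExponent b i = -b i := by
  rw [twistExponent, (Nat.not_odd_iff_even.1 h).add_one.neg_one_pow, neg_one_mul]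

theorem twoBridgeWord_eq : twoBridgeWord m b = twistWord (twistExponent b) 1 m := by
  rw [twoBridgeWord, twistWord, List.range'_eq_map_range, List.flatMap_map]
  congr 1
  funext j
  rw [add_comm 1 j]
  by_cases h : Odd (j + 1)
  · rw [if_pos h, if_pos h, twistExponent_of_odd b h]
  · rw [if_neg h, if_neg h, twistExponent_of_not_odd b h, Int.natAbs_neg]
    simp only [Left.neg_pos_iff]

theorem twoBridge_eq :
    twoBridge m b = fourPlat (twistWord (twistExponent b) 1 m) true (decide (Odd m)) := by
  have h : (if Odd m then ![1, 0, 3, 2] else ![3, 2, 1, 0] : Fin 4 → Fin 4) =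
      platCaps (decide (Odd m)) := by
    by_cases h : Odd m <;> simp [platCaps, h]
  simp only [twoBridge, fourPlat, twoBridgeWord_eq, h]
  rfl

variable {m b}

theorem even_twistExponent {i : ℕ} (h : Even (b i) ∧ b i ≠ 0) :
    Even (twistExponent b i) ∧ twistExponent b i ≠ 0 :=
  ⟨h.1.mul_left _, mul_ne_zero (pow_ne_zero _ (by norm_num)) h.2⟩

theorem typeSeq_eq_one_iff (i : ℕ) : typeSeq b i = 1 ↔ 0 < twistExponent b i := by
  rw [← Int.sign_eq_one_iff_pos]
  by_cases h : Odd i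
  · rw [typeSeq, twistExponent_of_odd b h, h.add_one.neg_one_pow, one_mul]
  · rw [typeSeq, twistExponent_of_not_odd b h, (Nat.not_odd_iff_even.1 h).add_one.neg_one_pow,
      neg_one_mul, Int.sign_neg]

theorem recDegree_twistExponent (hb : ∀ i ∈ Finset.Icc 1 m, Even (b i) ∧ b i ≠ 0)
    (hb0 : (b 0).sign = 1) :
    recDegree (twistExponent b) 1 m = ∑ i ∈ Finset.Icc 1 m,
      max ((-1) ^ (i + 1) * (b i : ℚ) + ((b i * b (i - 1)).sign : ℚ) / 2) (-1 / 2) := by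
  -- The convention sign(b_0) = 1 makes e_0 negative, so no positive run starts before index 1 and
  -- the correction term vanishes.
  have h0 : twistExponent b 0 < 0 := by
    rw [twistExponent_of_not_odd b (by decide), neg_lt_zero]
    exact Int.sign_eq_one_iff_pos.1 hb0
  have key := sum_max_eq_recDegree (twistExponent b) m 0
    (fun i hi => even_twistExponent (hb i (by simp at hi ⊢; omega))) h0.ne
  rw [if_neg (fun h => h0.not_gt h.1), sub_zero, zero_add] at key
  rw [← key]
  refine Finset.sum_congr (by ext; simp; omega) fun i hi => ?_
  obtain ⟨i, rfl⟩ := Nat.exists_eq_succ_of_ne_zero (by simp at hi; omega : i ≠ 0)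
  have hmul : twistExponent b (i + 1) * twistExponent b i = -(b (i + 1) * b i) := by
    have : ((-1 : ℤ) ^ (i + 1)) ^ 2 = 1 := by rw [← pow_mul, mul_comm, pow_mul]; norm_num
    simp only [twistExponent]
    linear_combination (-(b (i + 1) * b i)) * this
  simp only [Nat.succ_eq_add_one, Nat.add_sub_cancel]
  rw [hmul, Int.sign_neg, twistExponent]
  push_cast
  rw [neg_div, sub_neg_eq_add]

theorem recCoeff_twistExponent :
    recCoeff (twistExponent b) 1 m = (-1) ^ (m - plusPlusCount m b) := by
  rw [recCoeff_eq, plusPlusCount, Nat.add_sub_cancel_left]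
  simp only [typeSeq_eq_one_iff]

/-- The convention thus means that rows 1 and 2 are antiparallel at the left end; parallel strands
would give the first crossing the opposite sign. -/
theorem sign_first_eq_iff (hb : ∀ i ∈ Finset.Icc 1 m, Even (b i) ∧ b i ≠ 0)
    (o : (twoBridge m b).Orientation) (h : 0 < (twoBridge m b).word.length) :
    o.sign ⟨0, h⟩ = (b 1).sign ↔ o.dir (0, (1 : Fin 4)) ≠ o.dir (0, (2 : Fin 4)) := by
  have hm : 1 ≤ m := by
    by_contra! hm
    obtain rfl : m = 0 := by omega
    exact h.ne rfl
  have hne := (hb 1 (by simp [hm])).2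
  have hx : (twoBridgeWord m b).get ⟨0, h⟩ = (1, decide (0 < b 1)) := by
    obtain ⟨m, rfl⟩ : ∃ n, m = n + 1 := ⟨m - 1, by omega⟩
    obtain ⟨k, hk⟩ := Nat.exists_eq_succ_of_ne_zero (Int.natAbs_ne_zero.2 hne)
    have : twoBridgeWord (m + 1) b =
        (1, decide (0 < b 1)) :: (List.replicate k (1, decide (0 < b 1)) ++
          twistWord (twistExponent b) 2 m) := by
      rw [twoBridgeWord_eq, twistWord_succ, twistExponent_of_odd b odd_one, hk]
      rfl
    simp [this]
  have hs : o.sign ⟨0, h⟩ =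
      crossSign ((twoBridgeWord m b).get ⟨0, h⟩) fun ρ => o.dir (0, ρ) := rfl
  rw [hs, hx, ← boolSign_decide hne]
  constructor
  · intro h1 h2
    have h2' : o.dir (0, (Fin.castSucc 1 : Fin 4)) = o.dir (0, (Fin.succ 1 : Fin 4)) := h2
    rw [crossSign, h2'] at h1
    cases hd : decide (0 < b 1) <;> simp [hd, boolSign] at h1
  · intro h1
    exact crossSign_of_ne h1 _

theorem exists_isConventional (hb : ∀ i ∈ Finset.Icc 1 m, Even (b i) ∧ b i ≠ 0) :
    ∃ o : (twoBridge m b).Orientation, IsConventional m b o := by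
  -- Alternating directions are reversed by both systems of caps, and even twists carry them
  -- unchanged to the right end.
  let c : Fin 4 → Bool := ![true, false, true, false]
  have hcap : ∀ l ρ, c (platCaps l ρ) = !c ρ := by decide
  let o : (fourPlat (twistWord (twistExponent b) 1 m) true (decide (Odd m))).Orientation :=
    { dir := fun p => wordDir c (twistWord (twistExponent b) 1 m) p.1 p.2
      dir_left := fun ρ => by
        have : wordDir c (twistWord (twistExponent b) 1 m) 0 = c := wordDir_zero _ _
        exact (congrFun this _).trans ((hcap true ρ).trans (congrArg (!·) (congrFun this ρ).symm))
      dir_right := fun ρ => by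
        have : wordDir c (twistWord (twistExponent b) 1 m)
            (twistWord (twistExponent b) 1 m).length = c :=
          wordDir_twistWord c m 1 fun i h1 h2 =>
            (even_twistExponent (hb i (Finset.mem_Icc.2 ⟨h1, by omega⟩))).1
        exact (congrFun this _).trans ((hcap _ ρ).trans (congrArg (!·) (congrFun this ρ).symm))
      dir_cross := fun k ρ => wordDir_succ _ c k ρ }
  have hdir : ∃ o : (twoBridge m b).Orientation,
      o.dir (0, (1 : Fin 4)) ≠ o.dir (0, (2 : Fin 4)) := by
    -- An arbitrary diagram `D` allows the orientation to be transported along `twoBridge_eq`; `hn`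
    -- names its rows 1 and 2.
    have : ∀ D, D = fourPlat (twistWord (twistExponent b) 1 m) true (decide (Odd m)) →
        ∀ hn : D.n + 1 = 4, ∃ o : D.Orientation,
          o.dir (0, Fin.cast hn.symm 1) ≠ o.dir (0, Fin.cast hn.symm 2) := by
      rintro _ rfl hn
      refine ⟨o, ?_⟩
      show wordDir c _ 0 1 ≠ wordDir c _ 0 2
      rw [wordDir_zero]
      decide
    exact this _ (twoBridge_eq m b) rfl
  obtain ⟨o, ho⟩ := hdir
  exact ⟨o, fun h => (sign_first_eq_iff hb o h).2 ho⟩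

/-- The left caps and the convention make all adjacent rows antiparallel, so each twist contributes
its signed number of crossings. -/
theorem writhe_eq (hb : ∀ i ∈ Finset.Icc 1 m, Even (b i) ∧ b i ≠ 0)
    (o : (twoBridge m b).Orientation) (ho : IsConventional m b o) :
    o.writhe = ∑ i ∈ Finset.Ico 1 (1 + m), twistExponent b i := by
  rcases Nat.eq_zero_or_pos m with rfl | hm
  · rfl
  have h1 : 0 < (twoBridge m b).word.length := by
    obtain ⟨n, rfl⟩ : ∃ n, m = n + 1 := ⟨m - 1, by omega⟩
    have := Int.natAbs_pos.2 (hb 1 (by simp)).2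
    show 0 < (twoBridgeWord (n + 1) b).length
    rw [twoBridgeWord_eq, twistWord_succ, List.length_append, List.length_replicate,
      twistExponent_of_odd b odd_one]
    omega
  have h12 := (sign_first_eq_iff hb o h1).1 (ho h1)
  have h01 : o.dir (0, (1 : Fin 4)) = !o.dir (0, (0 : Fin 4)) := o.dir_left (0 : Fin 4)
  have h23 : o.dir (0, (3 : Fin 4)) = !o.dir (0, (2 : Fin 4)) := o.dir_left (2 : Fin 4)
  have key : o.writhe = wordWrithe (fun ρ => o.dir (0, ρ)) (twoBridgeWord m b) :=
    sum_crossSign (twoBridgeWord m b) (fun k ρ => o.dir (k, ρ)) o.dir_cross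
  rw [key, twoBridgeWord_eq, wordWrithe_twistWord _ m 1 fun i h1 h2 =>
    even_twistExponent (hb i (Finset.mem_Icc.2 ⟨h1, by omega⟩))]
  intro i
  fin_cases i
  · show o.dir (0, (0 : Fin 4)) ≠ o.dir (0, (1 : Fin 4))
    rw [h01]; simp
  · exact h12
  · show o.dir (0, (2 : Fin 4)) ≠ o.dir (0, (3 : Fin 4))
    rw [h23]; simp

theorem jones_eq_twistBracket (hb : ∀ i ∈ Finset.Icc 1 m, Even (b i) ∧ b i ≠ 0)
    (o : (twoBridge m b).Orientation) (ho : IsConventional m b o) :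
    o.jones = twistBracket (twistExponent b) m true 1 m := by
  have hev : Even o.writhe := by
    rw [writhe_eq hb o ho]
    exact Finset.even_sum _ fun i hi => (even_twistExponent (hb i (by simp at hi ⊢; omega))).1
  rw [LinkDiagram.Orientation.jones, Int.negOnePow_even _ hev, Units.val_one, one_smul,
    writhe_eq hb o ho, twistBracket, congrArg LinkDiagram.bracket (twoBridge_eq m b)]

end TwoBridge

theorem theorem5p6 (m : ℕ) (b : ℕ → ℤ)
    (hb : ∀ i ∈ Finset.Icc 1 m, Even (b i) ∧ b i ≠ 0)
    (hb0 : (b 0).sign = 1) :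
    (∃ o : (twoBridge m b).Orientation, IsConventional m b o) ∧
    ∀ o : (twoBridge m b).Orientation, IsConventional m b o →
      ∃ d : ℚ,
        d = ∑ i ∈ Finset.Icc 1 m,
          max ((-1) ^ (i + 1) * (b i : ℚ) + ((b i * b (i - 1)).sign : ℚ) / 2) (-1 / 2) ∧
        IsGreatest {q : ℚ | o.jones.coeff q ≠ 0} d ∧
        o.jones.coeff d = (-1) ^ (m - plusPlusCount m b) := by
  refine ⟨exists_isConventional hb, fun o ho => ⟨_, rfl, ?_⟩⟩
  have h := hasLead_twistBracket fun i h1 h2 =>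
    even_twistExponent (hb i (Finset.mem_Icc.2 ⟨h1, h2⟩))
  rw [← jones_eq_twistBracket hb o ho, recDegree_twistExponent hb hb0,
    recCoeff_twistExponent] at h
  refine ⟨⟨?_, fun q hq => ?_⟩, h.1⟩
  · rw [Set.mem_ofPred_eq, h.1]
    exact pow_ne_zero _ (by norm_num)
  · by_contra! hlt
    exact hq (h.2 q hlt)
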